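/- A digraph $G=(V,E)$ consists of a finite non-empty vertex set $V$ and a set $E$ of ordered pairs $(u,v)$ of distinct vertices (arcs). Write $u\to v$ if $(u,v)\in E$, and $u\leftrightarrow v$ if both $(u,v),(v,u)\in E$. For vertex-disjoint digraphs $G_1=(V_1,E_1)$ and $G_2=(V_2,E_2)$ let $G_1\oplus G_2$, $G_1\oslash G_2$, $G_1\otimes G_2$ be the digraphs on $V_1\cup V_2$ whose arcs are those of $E_1\cup E_2$ and, respectively, no others; all $(u,v)$ with $u\in V_1$, $v\in V_2$; all $(u,v)$ and $(v,u)$ with $u\in V_1$, $v\in V_2$. For undirected graphs, $\oplus$ is the disjoint union and $\otimes$ is the join. In both settings $\bullet$ denotes a one-vertex (di)graph. The complement $\mathrm{co}\text{-}G$ has as arcs the pairs $(u,v)\notin E$ with $u\ne v$. The underlying graph $un(G)$ has the edges $\{u,v\}$ with $(u,v)\in E$ or $(v,u)\in E$. A (di)graph is in $\mathrm{Free}(F)$ if none of its induced sub(di)graphs is isomorphic to a member of $F$. The class of directed co-trivially perfect graphs is the smallest class of digraphs that contains every one-vertex digraph, contains $G_1\otimes G_2$ whenever it contains $G_1$ and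 $G_2$, and contains $G\oslash\bullet$, $\bullet\oslash G$ and $G\oplus\bullet$ whenever it contains $G$. The class of (undirected) co-trivially perfect graphs is the smallest class of graphs that contains every one-vertex graph, contains $G_1\otimes G_2$ whenever it contains $G_1$ and $G_2$, and contains $G\oplus\bullet$ whenever it contains $G$. Let $I_2$ be the edgeless digraph, $\overrightarrow{P_2}$ the single arc, and $\overleftrightarrow{K_2}$ the bidirectional edge, each on two vertices. Define the following digraphs (all arcs are listed or given by the composition): - $D_1$: $a\to b\to c$; - $D_2$: $a\leftrightarrow b\to c$; - $D_3$: $a\leftrightarrow b\leftarrow c$; - $D_4=\mathrm{co}\text{-}D_1$ (up to isomorphism $a\to b\to c$, $a\leftrightarrow c$); - $D_5$: the directed cycle $a\to b\to c\to a$; - $D_7$: $a\leftrightarrow b\leftrightarrow c\leftrightarrow d$; - $D_8$: $a\to b\leftarrow c\to d$; - $D_6=\mathrm{co}\text{-}D_8$; - $D_9=I_2\otimes I_2$, $D_{10}=\overrightarrow{P_2}\otimes I_2$, $D_{11}=\overrightarrow{P_2}\otimes\overrightarrow{P_2}$; - $D_{12}=I_2\oslash I_2$, $D_{13}=I_2\oslash\overleftrightarrow{K_2}$,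 $D_{14}=\overleftrightarrow{K_2}\oslash I_2$, $D_{15}=\overleftrightarrow{K_2}\oslash\overleftrightarrow{K_2}$. **Theorem.** For every digraph $G$ the following are equivalent: 1. $G$ is a directed co-trivially perfect graph. 2. $G\in\mathrm{Free}(\{D_1,\dots,D_8,\mathrm{co}\text{-}D_{11},\mathrm{co}\text{-}D_{10},\mathrm{co}\text{-}D_9,D_{12},\dots,D_{15}\})$. 3. $G\in\mathrm{Free}(\{D_1,\dots,D_6,D_{12},\dots,D_{15}\})$ and $un(G)\in\mathrm{Free}(\{P_4,2K_2\})$, where $P_4$ is the path on four vertices and $2K_2$ is the disjoint union of two edges. 4. $G\in\mathrm{Free}(\{D_1,\dots,D_6,D_{12},\dots,D_{15}\})$ and $un(G)$ is a co-trivially perfect graph. -/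

import Mathlib

universe u v

namespace Digraph

/-- `G` has no loops. A finite digraph in the sense used here is a loopless `Digraph` on a
finite vertex type: its arcs are ordered pairs of distinct vertices. -/
def Loopless {V : Type u} (G : Digraph V) : Prop := ∀ x, ¬ G.Adj x x

/-- The complement digraph `co-G`: the arcs are the pairs of distinct vertices that are not arcs
of `G`. -/
def co {V : Type u} (G : Digraph V) : Digraph V where
  Adj x y := x ≠ y ∧ ¬ G.Adj x y

/-- The disjoint union `G ⊕ H`. -/
def disjUnion {V : Type u} {W : Type v} (G : Digraph V) (H : Digraph W) : Digraph (V ⊕ W) where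
  Adj
    | Sum.inl x, Sum.inl y => G.Adj x y
    | Sum.inr x, Sum.inr y => H.Adj x y
    | Sum.inl _, Sum.inr _ => False
    | Sum.inr _, Sum.inl _ => False

/-- The series composition `G ⊗ H`: all arcs in both directions between `G` and `H` are added to
the disjoint union. -/
def series {V : Type u} {W : Type v} (G : Digraph V) (H : Digraph W) : Digraph (V ⊕ W) where
  Adj
    | Sum.inl x, Sum.inl y => G.Adj x y
    | Sum.inr x, Sum.inr y => H.Adj x y
    | Sum.inl _, Sum.inr _ => True
    | Sum.inr _, Sum.inl _ => True

/-- The order composition `G ⊘ H`: all arcs from `G` to `H` are added to the disjoint union. -/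
def order {V : Type u} {W : Type v} (G : Digraph V) (H : Digraph W) : Digraph (V ⊕ W) where
  Adj
    | Sum.inl x, Sum.inl y => G.Adj x y
    | Sum.inr x, Sum.inr y => H.Adj x y
    | Sum.inl _, Sum.inr _ => True
    | Sum.inr _, Sum.inl _ => False

/-- The one-vertex digraph `•`. -/
def point : Digraph PUnit.{u + 1} := ⊥

/-- Directed co-trivially perfect graphs, defined recursively. The rule `iso` only says that the
names of the vertices do not matter (the compositions above take the disjoint union of the two
vertex types). -/
inductive IsDirectedCoTriviallyPerfect : {V : Type u} → Digraph V → Prop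
  | point : IsDirectedCoTriviallyPerfect point
  | series {V W : Type u} {G : Digraph V} {H : Digraph W} :
      IsDirectedCoTriviallyPerfect G → IsDirectedCoTriviallyPerfect H →
        IsDirectedCoTriviallyPerfect (G.series H)
  | order_point {V : Type u} {G : Digraph V} :
      IsDirectedCoTriviallyPerfect G → IsDirectedCoTriviallyPerfect (G.order Digraph.point.{u})
  | point_order {V : Type u} {G : Digraph V} :
      IsDirectedCoTriviallyPerfect G → IsDirectedCoTriviallyPerfect (Digraph.point.{u}.order G)
  | disjUnion_point {V : Type u} {G : Digraph V} :
      IsDirectedCoTriviallyPerfect G →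
        IsDirectedCoTriviallyPerfect (G.disjUnion Digraph.point.{u})
  | iso {V W : Type u} {G : Digraph V} {H : Digraph W} (e : G.Adj ≃r H.Adj) :
      IsDirectedCoTriviallyPerfect G → IsDirectedCoTriviallyPerfect H

/-- The underlying undirected graph `un(G)`: distinct vertices are adjacent if there is an arc
between them in at least one direction. -/
def un {V : Type u} (G : Digraph V) : SimpleGraph V := G.toSimpleGraphInclusive

/-- A digraph on `{0, …, n - 1}` for some `n`. -/
abbrev OnFin : Type := Σ n : ℕ, Digraph (Fin n)

/-- The digraph on `{0, …, n - 1}` with a given set of arcs. -/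
def ofArcs (n : ℕ) (A : Finset (Fin n × Fin n)) : OnFin := ⟨n, ⟨fun x y => (x, y) ∈ A⟩⟩

/-- The complement of a digraph on `{0, …, n - 1}`. -/
def OnFin.co (H : OnFin) : OnFin := ⟨H.1, H.2.co⟩

/-- `G ∈ Free(F)`: no induced subdigraph of `G` is isomorphic to a member of `F`. An embedding of
relations is an injective map that preserves and reflects arcs, that is, an isomorphism onto an
induced subdigraph. -/
def Free {V : Type u} (F : Set OnFin) (G : Digraph V) : Prop :=
  ∀ H ∈ F, IsEmpty (H.2.Adj ↪r G.Adj)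

/-- The directed path `0 → 1 → 2`. -/
def D1 : OnFin := ofArcs 3 {(0, 1), (1, 2)}

/-- `0 ↔ 1 → 2`. -/
def D2 : OnFin := ofArcs 3 {(0, 1), (1, 0), (1, 2)}

/-- `0 ↔ 1 ← 2`. -/
def D3 : OnFin := ofArcs 3 {(0, 1), (1, 0), (2, 1)}

/-- `0 → 1 → 2` together with `0 ↔ 2`, the complement of `D1`. -/
def D4 : OnFin := ofArcs 3 {(0, 1), (1, 2), (0, 2), (2, 0)}

/-- The directed cycle `0 → 1 → 2 → 0`. -/
def D5 : OnFin := ofArcs 3 {(0, 1), (1, 2), (2, 0)}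

/-- The bidirectional path `0 ↔ 1 ↔ 2 ↔ 3` together with `3 → 0`, `3 → 1`, `2 → 0`; this is the
complement of `D8`. -/
def D6 : OnFin := ofArcs 4
  {(0, 1), (1, 0), (1, 2), (2, 1), (2, 3), (3, 2), (3, 0), (3, 1), (2, 0)}

/-- The bidirectional path `0 ↔ 1 ↔ 2 ↔ 3`. -/
def D7 : OnFin := ofArcs 4 {(0, 1), (1, 0), (1, 2), (2, 1), (2, 3), (3, 2)}

/-- The alternating path `0 → 1 ← 2 → 3`. -/
def D8 : OnFin := ofArcs 4 {(0, 1), (2, 1), (2, 3)}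

/-- The bidirectional cycle on four vertices, that is, the series composition of two edgeless
digraphs on the vertices `0, 1` and `2, 3`. -/
def D9 : OnFin := ofArcs 4 {(0, 2), (2, 0), (0, 3), (3, 0), (1, 2), (2, 1), (1, 3), (3, 1)}

/-- The series composition of a single arc `0 → 1` and the edgeless digraph on `2, 3`. -/
def D10 : OnFin := ofArcs 4
  {(0, 1), (0, 2), (2, 0), (0, 3), (3, 0), (1, 2), (2, 1), (1, 3), (3, 1)}

/-- The series composition of two single arcs `0 → 1` and `2 → 3`. -/
def D11 : OnFin := ofArcs 4
  {(0, 1), (2, 3), (0, 2), (2, 0), (0, 3), (3, 0), (1, 2), (2, 1), (1, 3), (3, 1)}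

/-- The order composition of two edgeless digraphs on `0, 1` and `2, 3`. -/
def D12 : OnFin := ofArcs 4 {(0, 2), (0, 3), (1, 2), (1, 3)}

/-- The order composition of the edgeless digraph on `0, 1` and the bidirectional edge `2 ↔ 3`. -/
def D13 : OnFin := ofArcs 4 {(0, 2), (0, 3), (1, 2), (1, 3), (2, 3), (3, 2)}

/-- The order composition of the bidirectional edge `0 ↔ 1` and the edgeless digraph on `2, 3`. -/
def D14 : OnFin := ofArcs 4 {(0, 1), (1, 0), (0, 2), (0, 3), (1, 2), (1, 3)}

/-- The order composition of two bidirectional edges `0 ↔ 1` and `2 ↔ 3`. -/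
def D15 : OnFin := ofArcs 4 {(0, 1), (1, 0), (0, 2), (0, 3), (1, 2), (1, 3), (2, 3), (3, 2)}

end Digraph

namespace SimpleGraph

/-- The undirected join `G ⊗ H`: all edges between `G` and `H` are added to the disjoint union. -/
def joinSum {V : Type u} {W : Type v} (G : SimpleGraph V) (H : SimpleGraph W) :
    SimpleGraph (V ⊕ W) :=
  (G ⊕g H) ⊔ completeBipartiteGraph V W

/-- Co-trivially perfect graphs, defined recursively: the one-vertex graph `•`, the joins
`G ⊗ H`, and the disjoint unions `G ⊕ •` (up to the names of the vertices). -/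
inductive IsCoTriviallyPerfect : {V : Type u} → SimpleGraph V → Prop
  | point : IsCoTriviallyPerfect (⊥ : SimpleGraph PUnit.{u + 1})
  | join {V W : Type u} {G : SimpleGraph V} {H : SimpleGraph W} :
      IsCoTriviallyPerfect G → IsCoTriviallyPerfect H → IsCoTriviallyPerfect (G.joinSum H)
  | disjUnion_point {V : Type u} {G : SimpleGraph V} :
      IsCoTriviallyPerfect G → IsCoTriviallyPerfect (G ⊕g (⊥ : SimpleGraph PUnit.{u + 1}))
  | iso {V W : Type u} {G : SimpleGraph V} {H : SimpleGraph W} (e : G ≃g H) :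
      IsCoTriviallyPerfect G → IsCoTriviallyPerfect H

/-- The path `P₄` on four vertices. -/
def P4 : SimpleGraph (Fin 4) := pathGraph 4

/-- The graph `2K₂`, the disjoint union of two edges. -/
def twoK2 : SimpleGraph (Fin 2 ⊕ Fin 2) := (⊤ : SimpleGraph (Fin 2)) ⊕g (⊤ : SimpleGraph (Fin 2))

end SimpleGraph

/-! In a loopless digraph every pair of distinct vertices has one of three colours: one-way arc
(`Comparable`), `Both`, or `Apart`. Forbidding D1, D4, D5 makes the one-way relation transitive;
forbidding D2, D3 excludes triangles with three different colours.

3 → 1 is an induction on the number of vertices, driven by `Restricted.exists_decomposition`. If the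
graph of pairs that are not `Both` is disconnected, one of its components splits off in a series
composition. Otherwise that graph has no induced path or cycle on four vertices
(`not_both_path_free`), so, being connected, it has a universal vertex v
(`exists_forall_related_of_connected`). If the comparability graph is connected, the same argument
gives a vertex comparable to all others, and the absence of D12–D15 yields a source or a sink. If
not, the comparability component of v is apart from everything outside it, because v has no `Both`
pair and no triangle has three colours; the absence of 2K₂ in the underlying graph then leaves an
isolated vertex.

1 → 2 holds because no forbidden digraph is itself such a composition (`Indecomposable`), so a copy
inside a composition lies inside one factor. In 2 → 3, a P₄ or 2K₂ of the underlying graph lifts to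
a listed digraph. For 1 → 4 the recursion passes to underlying graphs, and 4 → 3 is the undirected
analogue of 1 → 2. -/

theorem injective_vec3 {V : Type*} {a b c : V} (hab : a ≠ b) (hac : a ≠ c) (hbc : b ≠ c) :
    (![a, b, c]).Injective := by
  simp [Function.Injective, Fin.forall_fin_succ, hab, hac, hbc, hab.symm, hac.symm, hbc.symm]

theorem injective_vec4 {V : Type*} {a b c d : V} (hab : a ≠ b) (hac : a ≠ c) (had : a ≠ d)
    (hbc : b ≠ c) (hbd : b ≠ d) (hcd : c ≠ d) : (![a, b, c, d]).Injective := by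
  simp [Function.Injective, Fin.forall_fin_succ, hab, hac, had, hbc, hbd, hcd, hab.symm, hac.symm,
    had.symm, hbc.symm, hbd.symm, hcd.symm]

/-- Lets an embedding into a composition be viewed as an embedding into one factor once its image
lies there. -/
theorem RelEmbedding.nonempty_of_factor {α X Y : Type*} {r : α → α → Prop} {s : X → X → Prop}
    {t : Y → Y → Prop} (f : r ↪r s) {k : Y → X} (hk : ∀ x y, s (k x) (k y) ↔ t x y)
    (h : ∀ i, ∃ x, f i = k x) : Nonempty (r ↪r t) := by
  choose g hg using h
  refine ⟨⟨⟨g, fun i j hij => f.injective (by rw [hg, hg, hij])⟩, fun {i j} => ?_⟩⟩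
  rw [← f.map_rel_iff, hg, hg]
  exact (hk _ _).symm

/-! ### Undirected joins and obstructions to co-trivial perfection -/

namespace SimpleGraph

section JoinSum

variable {V : Type u} {W : Type v} (G : SimpleGraph V) (H : SimpleGraph W)

@[simp] theorem joinSum_inl_inl (x y : V) :
    (G.joinSum H).Adj (Sum.inl x) (Sum.inl y) ↔ G.Adj x y := by simp [joinSum]

@[simp] theorem joinSum_inr_inr (x y : W) :
    (G.joinSum H).Adj (Sum.inr x) (Sum.inr y) ↔ H.Adj x y := by simp [joinSum]

@[simp] theorem joinSum_inl_inr (x : V) (y : W) :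
    (G.joinSum H).Adj (Sum.inl x) (Sum.inr y) := by simp [joinSum]

@[simp] theorem joinSum_inr_inl (x : W) (y : V) :
    (G.joinSum H).Adj (Sum.inr x) (Sum.inl y) := by simp [joinSum]

end JoinSum

/-- A copy of `H` in a join induces a join splitting of `H`, trivial by `hjoin`; a copy using the
added point of `G ⊕ •` would have an isolated vertex, against `hiso`. Either way the copy already
lies in a factor. -/
theorem IsCoTriviallyPerfect.not_isIndContained {α : Type*} {H : SimpleGraph α} [Nontrivial α]
    (hjoin : ∀ p : α → Bool, (∀ i j, p i = true → p j = false → H.Adj i j) →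
      (∀ i, p i = true) ∨ ∀ i, p i = false)
    (hiso : ∀ i, ∃ j, H.Adj i j) {V : Type u} {G : SimpleGraph V} (hG : G.IsCoTriviallyPerfect) :
    ¬ H.IsIndContained G := by
  induction hG with
  | point =>
    rintro ⟨f⟩
    obtain ⟨i, j, hij⟩ := exists_pair_ne α
    exact hij (f.injective rfl)
  | @join V W G₁ G₂ _ _ ih₁ ih₂ =>
    rintro ⟨f⟩
    rcases hjoin (fun i => (f i).isLeft) (fun i j hi hj => by
      rw [← f.map_rel_iff]
      rcases h : f i with x | x <;> rcases h' : f j with y | y <;> simp_all) with h | h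
    · exact ih₁ (f.nonempty_of_factor (k := Sum.inl) (by simp) fun i =>
        Sum.isLeft_iff.mp (h i))
    · exact ih₂ (f.nonempty_of_factor (k := Sum.inr) (by simp) fun i =>
        Sum.isRight_iff.mp (Sum.isLeft_eq_false.mp (h i)))
  | @disjUnion_point V G _ ih =>
    rintro ⟨f⟩
    by_cases h : ∀ i, ∃ x, f i = Sum.inl x
    · exact ih (f.nonempty_of_factor (by simp) h)
    · push Not at h
      obtain ⟨i, hi⟩ := h
      obtain ⟨j, hj⟩ := hiso i
      rw [← f.map_rel_iff] at hj
      rcases h : f i with x | x <;> rcases h' : f j with y | y <;> simp_all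
  | iso e _ ih =>
    rintro ⟨f⟩
    exact ih ⟨f.trans e.symm.toEmbedding⟩

theorem p4_isIndContained {V : Type*} {G : SimpleGraph V} {a b c d : V} (hab : G.Adj a b)
    (hbc : G.Adj b c) (hcd : G.Adj c d) (hac : ¬ G.Adj a c) (hbd : ¬ G.Adj b d)
    (had : ¬ G.Adj a d) : P4.IsIndContained G := by
  have ac : a ≠ c := by rintro rfl; exact had hcd
  have bd : b ≠ d := by rintro rfl; exact had hab
  have ad : a ≠ d := by rintro rfl; exact hac hcd.symm
  refine ⟨⟨⟨![a, b, c, d], injective_vec4 hab.ne ac ad hbc.ne bd hcd.ne⟩, fun {i j} => ?_⟩⟩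
  change G.Adj (![a, b, c, d] i) (![a, b, c, d] j) ↔ P4.Adj i j
  rw [P4, pathGraph_adj]
  fin_cases i <;> fin_cases j <;> simp [hab, hbc, hcd, hac, hbd, had, hab.symm, hbc.symm, hcd.symm,
    mt Adj.symm hac, mt Adj.symm hbd, mt Adj.symm had]

theorem twoK2_isIndContained {V : Type*} {G : SimpleGraph V} {a b c d : V} (hab : G.Adj a b)
    (hcd : G.Adj c d) (hac : ¬ G.Adj a c) (hbd : ¬ G.Adj b d) (had : ¬ G.Adj a d)
    (hbc : ¬ G.Adj b c) : twoK2.IsIndContained G := by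
  have ac : a ≠ c := by rintro rfl; exact had hcd
  have bd : b ≠ d := by rintro rfl; exact had hab
  have ad : a ≠ d := by rintro rfl; exact hac hcd.symm
  have bc : b ≠ c := by rintro rfl; exact hac hab
  have hinj : (Sum.elim ![a, b] ![c, d]).Injective := by
    rintro (i | i) (j | j) <;> fin_cases i <;> fin_cases j <;>
      simp [hab.ne, hab.ne', hcd.ne, hcd.ne', ac, ac.symm, bd, bd.symm, ad, ad.symm, bc, bc.symm]
  refine ⟨⟨⟨Sum.elim ![a, b] ![c, d], hinj⟩, fun {i j} => ?_⟩⟩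
  change G.Adj (Sum.elim ![a, b] ![c, d] i) (Sum.elim ![a, b] ![c, d] j) ↔ twoK2.Adj i j
  rcases i with i | i <;> rcases j with j | j <;> fin_cases i <;> fin_cases j <;>
    simp [twoK2, hab, hcd, hac, hbd, had, hbc, hab.symm, hcd.symm, mt Adj.symm hac,
      mt Adj.symm hbd, mt Adj.symm had, mt Adj.symm hbc]

end SimpleGraph

/-! ### Universal vertices in connected graphs without induced P₄ and C₄ -/

/-- In a finite symmetric relation that is connected and has no path `a, b, c, d` with both `a, c`
and `b, d` distinct and unrelated, some element is related to all others. -/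
theorem exists_forall_related_of_connected {V : Type*} [Finite V] [Nonempty V] {R : V → V → Prop}
    (hsymm : ∀ x y, R x y → R y x) (hconn : ∀ x y, Relation.ReflTransGen R x y)
    (hpath : ∀ a b c d, R a b → R b c → R c d → a ≠ c → ¬ R a c → b ≠ d → ¬ R b d → False) :
    ∃ v, ∀ w, w ≠ v → R v w := by
  -- A vertex with largest closed neighbourhood is universal.
  obtain ⟨v, hv⟩ := Finite.exists_max (fun v : V => {w | w = v ∨ R v w}.ncard)
  refine ⟨v, fun w hw => ?_⟩
  have key : w = v ∨ R v w := by
    have hvw := hconn v w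
    clear hw
    induction hvw with
    | refl => exact Or.inl rfl
    | @tail x y _ hxy ih =>
      by_contra hy
      push Not at hy
      rcases ih with rfl | hvx
      · exact hy.2 hxy
      -- A neighbour z of v outside the closed neighbourhood of x would make z, v, x, y a forbidden
      -- path. As y lies only in the neighbourhood of x, the inclusion is strict, against
      -- maximality.
      have hss : {w | w = v ∨ R v w} ⊂ {w | w = x ∨ R x w} := by
        refine ⟨?_, fun h => ?_⟩
        · rintro z (rfl | hz)
          · exact Or.inr (hsymm _ _ hvx)
          · by_contra hzx
            simp only [Set.mem_ofPred_eq, not_or] at hzx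
            exact hpath z v x y (hsymm _ _ hz) hvx hxy hzx.1 (fun h => hzx.2 (hsymm _ _ h))
              (Ne.symm hy.1) hy.2
        · rcases h (show y ∈ {w | w = x ∨ R x w} from Or.inr hxy) with h | h
          · exact hy.1 h
          · exact hy.2 h
      exact absurd (Set.ncard_lt_ncard hss) (not_lt.mpr (hv x))
  exact key.resolve_left hw

/-! ### Compositions, underlying graphs and necessity of the forbidden list -/

namespace Digraph

section Compositions

variable {V : Type u} {W : Type v} (G : Digraph V) (H : Digraph W)

@[simp] theorem series_inl_inl (x y : V) :
    (G.series H).Adj (Sum.inl x) (Sum.inl y) ↔ G.Adj x y := Iff.rfl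

@[simp] theorem series_inr_inr (x y : W) :
    (G.series H).Adj (Sum.inr x) (Sum.inr y) ↔ H.Adj x y := Iff.rfl

@[simp] theorem series_inl_inr (x : V) (y : W) :
    (G.series H).Adj (Sum.inl x) (Sum.inr y) := trivial

@[simp] theorem series_inr_inl (x : W) (y : V) :
    (G.series H).Adj (Sum.inr x) (Sum.inl y) := trivial

@[simp] theorem order_inl_inl (x y : V) :
    (G.order H).Adj (Sum.inl x) (Sum.inl y) ↔ G.Adj x y := Iff.rfl

@[simp] theorem order_inr_inr (x y : W) :
    (G.order H).Adj (Sum.inr x) (Sum.inr y) ↔ H.Adj x y := Iff.rfl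

@[simp] theorem order_inl_inr (x : V) (y : W) :
    (G.order H).Adj (Sum.inl x) (Sum.inr y) := trivial

@[simp] theorem order_inr_inl (x : W) (y : V) :
    ¬ (G.order H).Adj (Sum.inr x) (Sum.inl y) := id

@[simp] theorem disjUnion_inl_inl (x y : V) :
    (G.disjUnion H).Adj (Sum.inl x) (Sum.inl y) ↔ G.Adj x y := Iff.rfl

@[simp] theorem disjUnion_inr_inr (x y : W) :
    (G.disjUnion H).Adj (Sum.inr x) (Sum.inr y) ↔ H.Adj x y := Iff.rfl

@[simp] theorem disjUnion_inl_inr (x : V) (y : W) :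
    ¬ (G.disjUnion H).Adj (Sum.inl x) (Sum.inr y) := id

@[simp] theorem disjUnion_inr_inl (x : W) (y : V) :
    ¬ (G.disjUnion H).Adj (Sum.inr x) (Sum.inl y) := id

@[simp] theorem point_adj (x y : PUnit.{u + 1}) : ¬ Digraph.point.Adj x y := id

end Compositions

theorem un_adj {V : Type u} (G : Digraph V) (x y : V) :
    G.un.Adj x y ↔ x ≠ y ∧ (G.Adj x y ∨ G.Adj y x) := by
  simp [un, toSimpleGraphInclusive, SimpleGraph.fromRel_adj]

theorem Free.of_embedding {V : Type*} {W : Type*} {F : Set OnFin} {G : Digraph V} {H : Digraph W}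
    (f : H.Adj ↪r G.Adj) (h : G.Free F) : H.Free F :=
  fun D hD => ⟨fun e => (h D hD).false (e.trans f)⟩

/-- An embedding of digraphs is an embedding of the underlying graphs. -/
def unEmbedding {V W : Type u} {G : Digraph V} {H : Digraph W} (f : G.Adj ↪r H.Adj) :
    G.un ↪g H.un where
  toEmbedding := f.toEmbedding
  map_rel_iff' {a b} := by
    change H.un.Adj (f a) (f b) ↔ _
    rw [un_adj, un_adj, f.injective.ne_iff, f.map_rel_iff, f.map_rel_iff]

/-- Forgetting directions turns both order and series compositions into joins. -/
theorem IsDirectedCoTriviallyPerfect.un_isCoTriviallyPerfect {V : Type u} {G : Digraph V}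
    (hG : G.IsDirectedCoTriviallyPerfect) : G.un.IsCoTriviallyPerfect := by
  induction hG with
  | point =>
    convert SimpleGraph.IsCoTriviallyPerfect.point using 1
    ext x y
    simp
  | series _ _ ih₁ ih₂ =>
    convert SimpleGraph.IsCoTriviallyPerfect.join ih₁ ih₂ using 1
    ext (x | x) (y | y) <;> simp [un_adj]
  | order_point _ ih =>
    convert SimpleGraph.IsCoTriviallyPerfect.join ih SimpleGraph.IsCoTriviallyPerfect.point using 1
    ext (x | x) (y | y) <;> simp [un_adj]
  | point_order _ ih =>
    convert SimpleGraph.IsCoTriviallyPerfect.join SimpleGraph.IsCoTriviallyPerfect.point ih using 1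
    ext (x | x) (y | y) <;> simp [un_adj]
  | disjUnion_point _ ih =>
    convert SimpleGraph.IsCoTriviallyPerfect.disjUnion_point ih using 1
    ext (x | x) (y | y) <;> simp [un_adj]
  | @iso V W G H e _ ih =>
    refine SimpleGraph.IsCoTriviallyPerfect.iso ⟨e.toEquiv, fun {a b} => ?_⟩ ih
    exact (unEmbedding e.toRelEmbedding).map_rel_iff

/-- `H` is not a composition of the kinds generating the directed co-trivially perfect graphs. -/
def Indecomposable {α : Type*} (H : Digraph α) : Prop :=
  (∃ i j : α, i ≠ j) ∧
  (∀ p : α → Bool, (∀ i j, p i = true → p j = false → H.Adj i j ∧ H.Adj j i) →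
      (∀ i, p i = true) ∨ ∀ i, p i = false) ∧
  (∀ i, ∃ j, j ≠ i ∧ ¬ (H.Adj i j ∧ ¬ H.Adj j i)) ∧
  (∀ i, ∃ j, j ≠ i ∧ ¬ (H.Adj j i ∧ ¬ H.Adj i j)) ∧
  (∀ i, ∃ j, j ≠ i ∧ (H.Adj i j ∨ H.Adj j i))

instance {α : Type*} [Fintype α] [DecidableEq α] (H : Digraph α) [DecidableRel H.Adj] :
    Decidable H.Indecomposable := by
  unfold Indecomposable
  infer_instance

instance (n : ℕ) (A : Finset (Fin n × Fin n)) : DecidableRel (ofArcs n A).2.Adj :=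
  fun (x y : Fin n) => inferInstanceAs (Decidable ((x, y) ∈ A))

instance (n : ℕ) (A : Finset (Fin n × Fin n)) : DecidableRel (ofArcs n A).co.2.Adj :=
  fun (x y : Fin n) => inferInstanceAs (Decidable (x ≠ y ∧ ¬ (x, y) ∈ A))

/-- An embedding meeting both sides of a composition would give `H` a series splitting, or make the
preimage of the added point a sink, a source or an isolated vertex. -/
theorem IsDirectedCoTriviallyPerfect.isEmpty_embedding {α : Type*} {H : Digraph α}
    (hH : H.Indecomposable) {V : Type u} {G : Digraph V}
    (hG : G.IsDirectedCoTriviallyPerfect) : IsEmpty (H.Adj ↪r G.Adj) := by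
  obtain ⟨⟨i₀, j₀, hij₀⟩, hseries, hsource, hsink, hiso⟩ := hH
  induction hG with
  | point => exact ⟨fun f => hij₀ (f.injective rfl)⟩
  | @series V W G₁ G₂ _ _ ih₁ ih₂ =>
    refine ⟨fun f => ?_⟩
    rcases hseries (fun i => (f i).isLeft) (fun i j hi hj => by
      rw [← f.map_rel_iff, ← f.map_rel_iff]
      rcases h : f i with x | x <;> rcases h' : f j with y | y <;> simp_all) with h | h
    · exact (not_isEmpty_iff.mpr (f.nonempty_of_factor (k := Sum.inl) (by simp) fun i =>
        Sum.isLeft_iff.mp (h i))) ih₁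
    · exact (not_isEmpty_iff.mpr (f.nonempty_of_factor (k := Sum.inr) (by simp) fun i =>
        Sum.isRight_iff.mp (Sum.isLeft_eq_false.mp (h i)))) ih₂
  | @order_point V G _ ih =>
    refine ⟨fun f => ?_⟩
    by_cases h : ∀ i, ∃ x, f i = Sum.inl x
    · exact (not_isEmpty_iff.mpr (f.nonempty_of_factor (by simp) h)) ih
    · push Not at h
      obtain ⟨i, hi⟩ := h
      obtain ⟨j, hji, hj⟩ := hsink i
      rw [← f.map_rel_iff, ← f.map_rel_iff] at hj
      rw [← f.injective.ne_iff] at hji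
      rcases h : f i with x | x <;> rcases h' : f j with y | y <;> simp_all
  | @point_order V G _ ih =>
    refine ⟨fun f => ?_⟩
    by_cases h : ∀ i, ∃ x, f i = Sum.inr x
    · exact (not_isEmpty_iff.mpr (f.nonempty_of_factor (by simp) h)) ih
    · push Not at h
      obtain ⟨i, hi⟩ := h
      obtain ⟨j, hji, hj⟩ := hsource i
      rw [← f.map_rel_iff, ← f.map_rel_iff] at hj
      rw [← f.injective.ne_iff] at hji
      rcases h : f i with x | x <;> rcases h' : f j with y | y <;> simp_all
  | @disjUnion_point V G _ ih =>
    refine ⟨fun f => ?_⟩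
    by_cases h : ∀ i, ∃ x, f i = Sum.inl x
    · exact (not_isEmpty_iff.mpr (f.nonempty_of_factor (by simp) h)) ih
    · push Not at h
      obtain ⟨i, hi⟩ := h
      obtain ⟨j, hji, hj⟩ := hiso i
      rw [← f.map_rel_iff, ← f.map_rel_iff] at hj
      rw [← f.injective.ne_iff] at hji
      rcases h : f i with x | x <;> rcases h' : f j with y | y <;> simp_all
  | iso e _ ih => exact ⟨fun f => ih.false (f.trans e.symm.toRelEmbedding)⟩

theorem IsDirectedCoTriviallyPerfect.free {V : Type u} {G : Digraph V}
    (hG : G.IsDirectedCoTriviallyPerfect) :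
    G.Free {D1, D2, D3, D4, D5, D6, D7, D8, D11.co, D10.co, D9.co, D12, D13, D14, D15} := by
  intro D hD
  refine hG.isEmpty_embedding ?_
  simp only [Set.mem_insert_iff, Set.mem_singleton_iff] at hD
  rcases hD with rfl | rfl | rfl | rfl | rfl | rfl | rfl | rfl | rfl | rfl | rfl | rfl | rfl | rfl |
    rfl <;>
  -- Unfolding to `ofArcs` exposes the decidability instances; what remains is a check on three or
  -- four vertices.
  (simp only [D1, D2, D3, D4, D5, D6, D7, D8, D9, D10, D11, D12, D13, D14, D15]
   decide +kernel)

/-- With `Fin.forall_fin_succ`, `simp` turns this form of freeness into an implication between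
individual arcs and non-arcs. -/
theorem Free.false_of_three {V : Type*} {F : Set OnFin} {G : Digraph V} (h : G.Free F)
    {A : Finset (Fin 3 × Fin 3)} (hA : ofArcs 3 A ∈ F) (a b c : V)
    (hab : a ≠ b) (hac : a ≠ c) (hbc : b ≠ c)
    (hadj : ∀ i j, G.Adj (![a, b, c] i) (![a, b, c] j) ↔ (i, j) ∈ A) : False :=
  (h _ hA).false ⟨⟨![a, b, c], injective_vec3 hab hac hbc⟩,
    fun {i j} => hadj i j⟩

theorem Free.false_of_four {V : Type*} {F : Set OnFin} {G : Digraph V} (h : G.Free F)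
    {A : Finset (Fin 4 × Fin 4)} (hA : ofArcs 4 A ∈ F) (a b c d : V)
    (hab : a ≠ b) (hac : a ≠ c) (had : a ≠ d) (hbc : b ≠ c) (hbd : b ≠ d) (hcd : c ≠ d)
    (hadj : ∀ i j, G.Adj (![a, b, c, d] i) (![a, b, c, d] j) ↔ (i, j) ∈ A) : False :=
  (h _ hA).false ⟨⟨![a, b, c, d], injective_vec4 hab hac had hbc hbd hcd⟩,
    fun {i j} => hadj i j⟩

theorem Free.false_of_four_co {V : Type*} {F : Set OnFin} {G : Digraph V} (h : G.Free F)
    {A : Finset (Fin 4 × Fin 4)} (hA : (ofArcs 4 A).co ∈ F) (a b c d : V)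
    (hab : a ≠ b) (hac : a ≠ c) (had : a ≠ d) (hbc : b ≠ c) (hbd : b ≠ d) (hcd : c ≠ d)
    (hadj : ∀ i j, G.Adj (![a, b, c, d] i) (![a, b, c, d] j) ↔ i ≠ j ∧ (i, j) ∉ A) : False :=
  (h _ hA).false ⟨⟨![a, b, c, d], injective_vec4 hab hac had hbc hbd hcd⟩,
    fun {i j} => hadj i j⟩

/-! ### Forbidden subdigraphs as conditions on the colours of pairs -/

section Patterns

variable {V : Type u} (G : Digraph V)

/-- There is an arc from `x` to `y` and none back. -/
def OneWay (x y : V) : Prop := G.Adj x y ∧ ¬ G.Adj y x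

/-- There are arcs in both directions between `x` and `y`. -/
def Both (x y : V) : Prop := G.Adj x y ∧ G.Adj y x

/-- The distinct vertices `x` and `y` are not joined by an arc. -/
def Apart (x y : V) : Prop := x ≠ y ∧ ¬ G.Adj x y ∧ ¬ G.Adj y x

/-- There is an arc in exactly one direction between `x` and `y`. -/
def Comparable (x y : V) : Prop := G.OneWay x y ∨ G.OneWay y x

variable {G}

variable (G) in
/-- The pairwise conditions on arcs imposed by the forbidden induced subdigraphs. -/
structure Restricted : Prop where
  loopless : G.Loopless
  trans : ∀ a b c, G.OneWay a b → G.OneWay b c → G.OneWay a c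
  rainbow : ∀ a b c, G.Comparable a b → G.Both b c → G.Apart a c → False
  n_free : ∀ a b c d, G.OneWay a b → G.OneWay a c → G.OneWay d b → G.Both b c → G.Both c d →
    G.Both d a → False
  bowtie_free : ∀ a b c d, a ≠ b → c ≠ d → G.OneWay a c → G.OneWay a d → G.OneWay b c →
    G.OneWay b d → ¬ G.Comparable a b → ¬ G.Comparable c d → False
  path_free : ∀ a b c d, ¬ G.Apart a b → ¬ G.Apart b c → ¬ G.Apart c d → G.Apart a c →
    G.Apart b d → G.Apart a d → False
  two_edge_free : ∀ a b c d, a ≠ b → c ≠ d → ¬ G.Apart a b → ¬ G.Apart c d → G.Apart a c →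
    G.Apart b d → G.Apart a d → G.Apart b c → False

/-- If a → b → c are one-way arcs but a → c is not, then a and c are apart (D1), joined both ways
(D4), or c → a (D5). A three-coloured triangle is D2 or D3, according to the direction of its single
arc. `F` is arbitrary so that this serves both forbidden lists. -/
theorem Free.trans_and_rainbow (hG : G.Loopless) {F : Set OnFin} (h : G.Free F)
    (hF : {D1, D2, D3, D4, D5} ⊆ F) :
    (∀ a b c, G.OneWay a b → G.OneWay b c → G.OneWay a c) ∧
    (∀ a b c, G.Comparable a b → G.Both b c → G.Apart a c → False) := by
  have g1 := h.false_of_three (hF (by simp : D1 ∈ _))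
  have g2 := h.false_of_three (hF (by simp : D2 ∈ _))
  have g3 := h.false_of_three (hF (by simp : D3 ∈ _))
  have g4 := h.false_of_three (hF (by simp : D4 ∈ _))
  have g5 := h.false_of_three (hF (by simp : D5 ∈ _))
  clear h hF
  unfold Loopless at hG
  simp [Fin.forall_fin_succ, hG] at g1 g2 g3 g4 g5
  unfold Comparable OneWay Both Apart
  constructor
  · intro a b c
    specialize g1 a b c
    specialize g4 a b c
    specialize g5 a b c
    clear g2 g3
    rcases eq_or_ne a b with rfl | hab
    · grind
    rcases eq_or_ne b c with rfl | hbc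
    · grind
    rcases eq_or_ne a c with rfl | hac <;> grind
  · intro a b c
    specialize g2 c b a
    specialize g3 c b a
    clear g1 g4 g5
    rcases eq_or_ne a b with rfl | hab
    · grind
    rcases eq_or_ne b c with rfl | hbc <;> grind

theorem restricted_of_free (hG : G.Loopless)
    (h : G.Free {D1, D2, D3, D4, D5, D6, D12, D13, D14, D15})
    (hP : ¬ SimpleGraph.P4.IsIndContained G.un) (hK : ¬ SimpleGraph.twoK2.IsIndContained G.un) :
    G.Restricted := by
  have h3 := h.trans_and_rainbow hG (by simp [Set.insert_subset_iff])
  have g6 := h.false_of_four (by simp : D6 ∈ _)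
  have g12 := h.false_of_four (by simp : D12 ∈ _)
  have g13 := h.false_of_four (by simp : D13 ∈ _)
  have g14 := h.false_of_four (by simp : D14 ∈ _)
  have g15 := h.false_of_four (by simp : D15 ∈ _)
  clear h
  have hG' : ∀ x, ¬ G.Adj x x := hG
  simp [Fin.forall_fin_succ, hG'] at g6 g12 g13 g14 g15
  refine ⟨hG, h3.1, h3.2, ?_, ?_, ?_, ?_⟩
  · unfold OneWay Both
    intro a b c d
    -- The bidirectional path of D6 runs b, c, d, a.
    specialize g6 b c d a
    clear g12 g13 g14 g15 hP hK h3
    rcases eq_or_ne a b with rfl | hab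
    · grind
    rcases eq_or_ne a c with rfl | hac
    · grind
    rcases eq_or_ne a d with rfl | had
    · grind
    rcases eq_or_ne b c with rfl | hbc
    · grind
    rcases eq_or_ne b d with rfl | hbd
    · grind
    rcases eq_or_ne c d with rfl | hcd <;> grind
  · unfold Comparable OneWay
    intro a b c d
    -- Each of the pairs a, b and c, d is apart or joined both ways; the four combinations are
    -- D12–D15.
    specialize g12 a b c d
    specialize g13 a b c d
    specialize g14 a b c d
    specialize g15 a b c d
    clear g6 hP hK h3
    intro hab hcd hac had hbc hbd
    have hne : ∀ x y, G.Adj x y → x ≠ y := by rintro x _ h rfl; exact hG' x h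
    have := hne _ _ hac.1
    have := hne _ _ had.1
    have := hne _ _ hbc.1
    have := hne _ _ hbd.1
    grind
  · unfold Apart
    intro a b c d hab hbc hcd hac hbd had
    refine hP (SimpleGraph.p4_isIndContained (a := a) (b := b) (c := c) (d := d) ?_ ?_ ?_ ?_ ?_ ?_)
      <;> rw [un_adj] <;> grind
  · unfold Apart
    intro a b c d hne hne' hab hcd hac hbd had hbc
    refine hK (SimpleGraph.twoK2_isIndContained (a := a) (b := b) (c := c) (d := d)
      ?_ ?_ ?_ ?_ ?_ ?_) <;> rw [un_adj] <;> grind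

theorem Restricted.of_embedding {W : Type*} {H : Digraph W} (f : H.Adj ↪r G.Adj)
    (h : G.Restricted) : H.Restricted := by
  have hA : ∀ x y, H.Adj x y ↔ G.Adj (f x) (f y) := fun x y => f.map_rel_iff.symm
  have hne : ∀ x y, x ≠ y ↔ f x ≠ f y := fun x y => f.injective.ne_iff.symm
  obtain ⟨h0, h1, h2, h3, h4, h5, h6⟩ := h
  refine ⟨fun x => ?_, fun a b c => ?_, fun a b c => ?_, fun a b c d => ?_, fun a b c d => ?_,
    fun a b c d => ?_, fun a b c d => ?_⟩ <;>
  simp only [OneWay, Comparable, Apart, Both, hA, hne] at *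
  · exact h0 _
  · exact h1 _ _ _
  · exact h2 _ _ _
  · exact h3 _ _ _ _
  · exact h4 _ _ _ _
  · exact h5 _ _ _ _
  · exact h6 _ _ _ _

/-! ### Induced paths and cycles in the colour graphs, and the decomposition -/

theorem Comparable.symm {x y : V} (h : G.Comparable x y) : G.Comparable y x := Or.symm h

theorem Both.symm {x y : V} (h : G.Both x y) : G.Both y x := And.symm h

theorem Apart.symm {x y : V} (h : G.Apart x y) : G.Apart y x := ⟨h.1.symm, h.2.2, h.2.1⟩

theorem Comparable.not_both {x y : V} (h : G.Comparable x y) : ¬ G.Both x y := by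
  unfold Comparable OneWay Both at *
  tauto

theorem Comparable.not_apart {x y : V} (h : G.Comparable x y) : ¬ G.Apart x y := by
  unfold Comparable OneWay Apart at *
  tauto

theorem Both.not_apart {x y : V} (h : G.Both x y) : ¬ G.Apart x y := fun h' => h'.2.1 h.1

theorem trichotomy {x y : V} (hne : x ≠ y) : G.Comparable x y ∨ G.Both x y ∨ G.Apart x y := by
  unfold Comparable OneWay Both Apart
  tauto

theorem Comparable.ne {x y : V} (hxy : G.Comparable x y) : x ≠ y := by
  rintro rfl
  exact hxy.elim (fun h => h.2 h.1) (fun h => h.2 h.1)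

theorem Restricted.comparable_path_free (h : G.Restricted) (a b c d : V)
    (hab : G.Comparable a b) (hbc : G.Comparable b c) (hcd : G.Comparable c d) (hac : a ≠ c)
    (hac' : ¬ G.Comparable a c) (hbd : b ≠ d) (hbd' : ¬ G.Comparable b d) : False := by
  have had : a ≠ d := by rintro rfl; exact hbd' hab.symm
  -- If a, d are not comparable, the triangles a, c, d and a, b, d already have a comparable side,
  -- so their other two sides share a colour.
  have cases_ad : G.Comparable a d ∨
      (G.Both a c ∧ G.Both b d ∧ G.Both a d) ∨ (G.Apart a c ∧ G.Apart b d ∧ G.Apart a d) := by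
    rcases trichotomy (G := G) had with had | had | had
    · exact Or.inl had
    · refine Or.inr (Or.inl ⟨?_, ?_, had⟩)
      · exact ((trichotomy hac).resolve_left hac').resolve_right
          fun h' => h.rainbow c d a hcd had.symm h'.symm
      · exact ((trichotomy hbd).resolve_left hbd').resolve_right
          fun h' => h.rainbow b a d hab.symm had h'
    · refine Or.inr (Or.inr ⟨?_, ?_, had⟩)
      · exact ((trichotomy hac).resolve_left hac').resolve_left
          fun h' => h.rainbow d c a hcd.symm h'.symm had.symm
      · exact ((trichotomy hbd).resolve_left hbd').resolve_left
          fun h' => h.rainbow a b d hab h' had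
  -- Two consecutive arcs in the same direction would compose to a forbidden chord, so directions
  -- alternate.
  have orient : (G.OneWay a b ∧ G.OneWay c b ∧ G.OneWay c d) ∨
      (G.OneWay b a ∧ G.OneWay b c ∧ G.OneWay d c) := by
    rcases hab with hab | hab <;> rcases hbc with hbc | hbc <;> rcases hcd with hcd | hcd
    · exact absurd (Or.inl (h.trans _ _ _ hab hbc)) hac'
    · exact absurd (Or.inl (h.trans _ _ _ hab hbc)) hac'
    · exact Or.inl ⟨hab, hbc, hcd⟩
    · exact absurd (Or.inr (h.trans _ _ _ hcd hbc)) hbd'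
    · exact absurd (Or.inl (h.trans _ _ _ hbc hcd)) hbd'
    · exact Or.inr ⟨hab, hbc, hcd⟩
    · exact absurd (Or.inr (h.trans _ _ _ hbc hab)) hac'
    · exact absurd (Or.inr (h.trans _ _ _ hbc hab)) hac'
  rcases cases_ad with had' | ⟨b₁, b₂, b₃⟩ | ⟨n₁, n₂, n₃⟩
  · rcases orient with ⟨h₁, h₂, h₃⟩ | ⟨h₁, h₂, h₃⟩ <;> rcases had' with had' | had'
    · exact h.bowtie_free a c b d hac hbd h₁ had' h₂ h₃ hac' hbd'
    · exact hbd' (Or.inr (h.trans _ _ _ had' h₁))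
    · exact hbd' (Or.inl (h.trans _ _ _ h₁ had'))
    · exact h.bowtie_free b d a c hbd hac h₁ h₂ had' h₃ hbd' hac'
  · rcases orient with ⟨h₁, h₂, h₃⟩ | ⟨h₁, h₂, h₃⟩
    · exact h.n_free c b d a h₂ h₃ h₁ b₂ b₃.symm b₁
    · exact h.n_free b c a d h₂ h₁ h₃ b₁.symm b₃ b₂.symm
  · exact h.path_free a b c d hab.not_apart hbc.not_apart hcd.not_apart n₁ n₂ n₃

/-- The colour of b, c spreads: a triangle with a `Both` side and a b, c side of another colour
forces its third side. So the path is entirely comparable, which `comparable_path_free` excludes, or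
entirely apart; then every colour of a, d gives a contradiction, namely a three-coloured triangle, a
P₄ or a 2K₂. -/
theorem Restricted.not_both_path_free (h : G.Restricted) (a b c d : V)
    (hab : ¬ G.Both a b) (hbc : ¬ G.Both b c) (hcd : ¬ G.Both c d) (hab' : a ≠ b) (hbc' : b ≠ c)
    (hcd' : c ≠ d) (hac : G.Both a c) (hbd : G.Both b d) : False := by
  have hac' : a ≠ c := by rintro rfl; exact h.loopless _ hac.1
  have hbd' : b ≠ d := by rintro rfl; exact h.loopless _ hbd.1
  rcases trichotomy (G := G) hbc' with c₂ | c₂ | c₂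
  · have c₁ : G.Comparable a b := (trichotomy hab').resolve_right fun h' =>
      h'.elim hab fun h' => h.rainbow b c a c₂ hac.symm h'.symm
    have c₃ : G.Comparable c d := (trichotomy hcd').resolve_right fun h' =>
      h'.elim hcd fun h' => h.rainbow c b d c₂.symm hbd h'
    exact h.comparable_path_free a b c d c₁ c₂ c₃ hac' (fun h' => h'.not_both hac) hbd'
      (fun h' => h'.not_both hbd)
  · exact hbc c₂
  · have c₁ : G.Apart a b := ((trichotomy hab').resolve_left fun h' =>
      h.rainbow b a c h'.symm hac c₂).resolve_left hab
    have c₃ : G.Apart c d := ((trichotomy hcd').resolve_left fun h' =>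
      h.rainbow c d b h' hbd.symm c₂.symm).resolve_left hcd
    have had : a ≠ d := by rintro rfl; exact hab hbd.symm
    rcases trichotomy (G := G) had with c₄ | c₄ | c₄
    · exact h.rainbow d a c c₄.symm hac c₃.symm
    · exact h.path_free c a d b hac.symm.not_apart c₄.not_apart hbd.symm.not_apart c₃ c₁ c₂.symm
    · exact h.two_edge_free a c b d hac' hbd' hac.not_apart hbd.not_apart c₁ c₃ c₄ c₂.symm

theorem Restricted.exists_source_or_sink [Finite V] (h : G.Restricted) {v : V}
    (hv : ∀ w, w ≠ v → G.Comparable v w) :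
    (∃ u, ∀ w, w ≠ u → G.OneWay u w) ∨ ∃ u, ∀ w, w ≠ u → G.OneWay w u := by
  by_contra! hcon
  obtain ⟨hsource, hsink⟩ := hcon
  have : IsTrans V G.OneWay := ⟨h.trans⟩
  have : Std.Irrefl G.OneWay := ⟨fun x hx => hx.2 hx.1⟩
  have wf : WellFounded G.OneWay := Finite.wellFounded_of_trans_of_irrefl _
  have wf' : WellFounded (Function.swap G.OneWay) := Finite.wellFounded_of_trans_of_irrefl _
  obtain ⟨l₀, hl₀, hl₀'⟩ := hsink v
  obtain ⟨u₀, hu₀, hu₀'⟩ := hsource v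
  -- Take l minimal below v and u maximal above v. As l is not a source and u not a sink, there are
  -- l' incomparable to l and u' incomparable to u; comparability with v puts l' below and u' above
  -- it, so l, l', u, u' form a D12–D15 pattern.
  obtain ⟨l, hl, hmin⟩ := wf.has_min {x | G.OneWay x v} ⟨u₀, (hv _ hu₀).resolve_left hu₀'⟩
  obtain ⟨u, hu, hmax⟩ := wf'.has_min {x | G.OneWay v x} ⟨l₀, (hv _ hl₀).resolve_right hl₀'⟩
  obtain ⟨l', hll', hl'⟩ := hsource l
  obtain ⟨u', huu', hu'⟩ := hsink u
  have hl'v : G.OneWay l' v := by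
    rcases eq_or_ne l' v with rfl | hne
    · exact absurd hl hl'
    · exact (hv _ hne).resolve_left fun h' => hl' (h.trans _ _ _ hl h')
  have hu'v : G.OneWay v u' := by
    rcases eq_or_ne u' v with rfl | hne
    · exact absurd hu hu'
    · exact (hv _ hne).resolve_right fun h' => hu' (h.trans _ _ _ h' hu)
  exact h.bowtie_free l l' u u' hll'.symm huu'.symm (h.trans _ _ _ hl hu) (h.trans _ _ _ hl hu'v)
    (h.trans _ _ _ hl'v hu) (h.trans _ _ _ hl'v hu'v)
    (fun h' => h'.elim hl' (hmin _ hl'v)) (fun h' => h'.elim (hmax _ hu'v) hu')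

theorem Restricted.exists_decomposition [Finite V] [Nonempty V] (h : G.Restricted) :
    (∃ A : Set V, A.Nonempty ∧ Aᶜ.Nonempty ∧ ∀ x ∈ A, ∀ y ∉ A, G.Both x y) ∨
    (∃ v, ∀ w, w ≠ v → G.Apart w v) ∨ (∃ v, ∀ w, w ≠ v → G.OneWay v w) ∨
    ∃ v, ∀ w, w ≠ v → G.OneWay w v := by
  by_cases hconn : ∀ x y, Relation.ReflTransGen (fun x y => x ≠ y ∧ ¬ G.Both x y) x y
  swap
  · push Not at hconn
    obtain ⟨x, y, hxy⟩ := hconn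
    -- Any pair leaving a component of the not-`Both` graph is `Both`.
    refine Or.inl ⟨{z | Relation.ReflTransGen (fun x y => x ≠ y ∧ ¬ G.Both x y) x z},
      ⟨x, Relation.ReflTransGen.refl⟩, ⟨y, hxy⟩, fun a ha b hb => ?_⟩
    by_contra hab
    exact hb (Relation.ReflTransGen.tail ha ⟨by rintro rfl; exact hb ha, hab⟩)
  obtain ⟨v, hv⟩ := exists_forall_related_of_connected
    (fun x y h => ⟨h.1.symm, fun h' => h.2 h'.symm⟩) hconn
    (fun a b c d hab hbc hcd hac hac' hbd hbd' => by
      simp only [not_and, not_not] at hac' hbd'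
      exact h.not_both_path_free a b c d hab.2 hbc.2 hcd.2 hab.1 hbc.1 hcd.1 (hac' hac)
        (hbd' hbd))
  right
  have : Std.Symm G.Comparable := ⟨fun _ _ h => h.symm⟩
  have hsymm : ∀ x y, Relation.ReflTransGen G.Comparable x y →
      Relation.ReflTransGen G.Comparable y x := fun _ _ h => symm h
  by_cases hK : ∀ w, Relation.ReflTransGen G.Comparable v w
  · obtain ⟨u, hu⟩ := exists_forall_related_of_connected (fun _ _ h => Comparable.symm h)
      (fun x y => (Relation.ReflTransGen.trans (hsymm _ _ (hK x)) (hK y))) h.comparable_path_free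
    exact Or.inr (h.exists_source_or_sink hu)
  push Not at hK
  obtain ⟨y, hy⟩ := hK
  -- No z outside the component of v is `Both` with v, so v and z are apart. This spreads along
  -- comparabilities, since a `Both` pair would complete a three-coloured triangle.
  have hapart : ∀ z, ¬ Relation.ReflTransGen G.Comparable v z → ∀ x,
      Relation.ReflTransGen G.Comparable v x → G.Apart x z := by
    intro z hz x hx
    induction hx with
    | refl =>
      have hzv : z ≠ v := by rintro rfl; exact hz Relation.ReflTransGen.refl
      exact ((trichotomy hzv.symm).resolve_left fun h' =>
        hz (Relation.ReflTransGen.single h')).resolve_left (hv z hzv).2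
    | @tail a b ha hab ih =>
      have hbz : b ≠ z := by rintro rfl; exact hz (ha.tail hab)
      exact ((trichotomy hbz).resolve_left fun h' =>
        hz ((ha.tail hab).tail h')).resolve_left fun h' => h.rainbow a b z hab h' ih
  left
  by_cases hv' : ∃ x, G.Comparable v x
  · obtain ⟨x, hx⟩ := hv'
    refine ⟨y, fun w hw => ?_⟩
    by_cases hw' : Relation.ReflTransGen G.Comparable v w
    · exact hapart y hy w hw'
    · by_contra hwy
      -- An edge w, y outside the component, together with v, x inside it, would be a 2K₂.
      exact h.two_edge_free v x w y hx.ne hw hx.not_apart hwy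
        (hapart w hw' v .refl) (hapart y hy x (.single hx)) (hapart y hy v .refl)
        (hapart w hw' x (.single hx))
  · push Not at hv'
    refine ⟨v, fun w hw => (hapart w (fun hvw => ?_) v .refl).symm⟩
    rcases Relation.ReflTransGen.cases_head hvw with h' | ⟨x, hx, _⟩
    · exact hw h'.symm
    · exact hv' x hx

/-! ### Rebuilding the digraph by induction on its order -/

/-- The subdigraph induced by a set of vertices. -/
def inducedOn (G : Digraph V) (A : Set V) : Digraph A := ⟨fun x y => G.Adj x y⟩

/-- An induced subdigraph embeds into the whole digraph. -/
def inducedOnEmbedding (G : Digraph V) (A : Set V) : (G.inducedOn A).Adj ↪r G.Adj :=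
  ⟨⟨Subtype.val, Subtype.val_injective⟩, Iff.rfl⟩

theorem Restricted.isDirectedCoTriviallyPerfect : ∀ {V : Type u} [Finite V] [Nonempty V]
    {G : Digraph V}, G.Restricted → G.IsDirectedCoTriviallyPerfect := by
  suffices ∀ n : ℕ, ∀ (V : Type u) [Finite V] [Nonempty V] (G : Digraph V), Nat.card V = n →
      G.Restricted → G.IsDirectedCoTriviallyPerfect from
    fun {V} _ _ {G} h => this _ V G rfl h
  intro n
  induction n using Nat.strong_induction_on with
  | _ n ih =>
  intro V _ _ G hn h
  have ind : ∀ A : Set V, A.Nonempty → Aᶜ.Nonempty →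
      (G.inducedOn A).IsDirectedCoTriviallyPerfect := by
    rintro A hA ⟨x, hx⟩
    have := hA.to_subtype
    exact ih _ (hn ▸ Finite.card_subtype_lt hx) A _ rfl (h.of_embedding (G.inducedOnEmbedding A))
  have l : ∀ x, ¬ G.Adj x x := h.loopless
  rcases subsingleton_or_nontrivial V with hs | hs
  · obtain ⟨v⟩ := ‹Nonempty V›
    refine .iso ⟨⟨fun _ => v, fun _ => ⟨⟩, fun _ => rfl, fun _ => Subsingleton.elim _ _⟩, ?_⟩ .point
    intro a b
    simpa using l v
  have compl_point : ∀ v : V, (G.inducedOn {v}ᶜ).IsDirectedCoTriviallyPerfect := by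
    intro v
    obtain ⟨w, hw⟩ := exists_ne v
    exact ind _ ⟨w, hw⟩ ⟨v, by simp⟩
  have bij : ∀ v : V, Function.Bijective
      (Sum.elim Subtype.val (fun _ => v) : ({v}ᶜ : Set V) ⊕ PUnit.{u + 1} → V) := by
    intro v
    constructor
    · rintro (⟨x, hx⟩ | x) (⟨y, hy⟩ | y) hxy
      · exact congrArg Sum.inl (Subtype.ext hxy)
      · exact absurd hxy hx
      · exact absurd hxy.symm hy
      · rfl
    · intro x
      by_cases hx : x = v
      · exact ⟨Sum.inr ⟨⟩, hx.symm⟩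
      · exact ⟨Sum.inl ⟨x, hx⟩, rfl⟩
  have bij' : ∀ v : V, Function.Bijective
      (Sum.elim (fun _ => v) Subtype.val : PUnit.{u + 1} ⊕ ({v}ᶜ : Set V) → V) := by
    intro v
    convert (bij v).comp (Equiv.sumComm _ _).bijective using 1
    ext (x | x) <;> rfl
  rcases h.exists_decomposition with ⟨A, hA, hA', hAB⟩ | ⟨v, hv⟩ | ⟨v, hv⟩ | ⟨v, hv⟩
  · classical
    refine .iso ⟨Equiv.Set.sumCompl A, ?_⟩ (.series (ind A hA hA') (ind Aᶜ hA' (by simpa)))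
    rintro (⟨x, hx⟩ | ⟨x, hx⟩) (⟨y, hy⟩ | ⟨y, hy⟩)
    · simp [inducedOn]
    · simpa using (hAB x hx y hy).1
    · simpa using (hAB y hy x hx).2
    · simp [inducedOn]
  · refine .iso ⟨Equiv.ofBijective _ (bij v), ?_⟩ (.disjUnion_point (compl_point v))
    rintro (⟨x, hx⟩ | x) (⟨y, hy⟩ | y)
    · simp [inducedOn]
    · simpa using (hv x hx).2.1
    · simpa using (hv y hy).2.2
    · simpa using l v
  · refine .iso ⟨Equiv.ofBijective _ (bij' v), ?_⟩ (.point_order (compl_point v))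
    rintro (x | ⟨x, hx⟩) (y | ⟨y, hy⟩)
    · simpa using l v
    · simpa using (hv y hy).1
    · simpa using (hv x hx).2
    · simp [inducedOn]
  · refine .iso ⟨Equiv.ofBijective _ (bij v), ?_⟩ (.order_point (compl_point v))
    rintro (⟨x, hx⟩ | x) (⟨y, hy⟩ | y)
    · simp [inducedOn]
    · simpa using (hv x hx).1
    · simpa using (hv y hy).2
    · simpa using l v

/-! ### Lifting P₄ and 2K₂ from the underlying graph -/

theorem un_adj_iff_not_apart {x y : V} (hne : x ≠ y) : G.un.Adj x y ↔ ¬ G.Apart x y := by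
  rw [un_adj]
  unfold Apart
  tauto

theorem Free.not_p4_isIndContained_un (hG : G.Loopless)
    (h : G.Free {D1, D2, D3, D4, D5, D6, D7, D8, D11.co, D10.co, D9.co, D12, D13, D14, D15}) :
    ¬ SimpleGraph.P4.IsIndContained G.un := by
  rintro ⟨f⟩
  obtain ⟨htrans, hrainbow⟩ := h.trans_and_rainbow hG (by simp [Set.insert_subset_iff])
  have hne : ∀ i j, i ≠ j → f i ≠ f j := fun i j => f.injective.ne
  have hadj : ∀ i j, i ≠ j → (G.Apart (f i) (f j) ↔ ¬ SimpleGraph.P4.Adj i j) := fun i j hij => by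
    rw [← f.map_adj_iff, un_adj_iff_not_apart (hne i j hij), not_not]
  have hl : ∀ x, ¬ G.Adj x x := hG
  have n01 := hne 0 1 (by simp)
  have n02 := hne 0 2 (by simp)
  have n03 := hne 0 3 (by simp)
  have n12 := hne 1 2 (by simp)
  have n13 := hne 1 3 (by simp)
  have n23 := hne 2 3 (by simp)
  have g7 := h.false_of_four (by simp : D7 ∈ _) (f 0) (f 1) (f 2) (f 3)
  have g8 := h.false_of_four (by simp : D8 ∈ _) (f 0) (f 1) (f 2) (f 3)
  have g8' := h.false_of_four (by simp : D8 ∈ _) (f 3) (f 2) (f 1) (f 0)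
  simp [n01, n02, n03, n12, n13, n23, n01.symm, n02.symm, n03.symm, n12.symm, n13.symm,
    n23.symm, Fin.forall_fin_succ, hl] at g7 g8 g8'
  simp only [SimpleGraph.P4, SimpleGraph.pathGraph_adj] at hadj
  have h01 := (hadj 0 1 (by simp)).not.mpr (by simp)
  have h12 := (hadj 1 2 (by simp)).not.mpr (by simp)
  have h23 := (hadj 2 3 (by simp)).not.mpr (by simp)
  have h02 := (hadj 0 2 (by simp)).mpr (by simp)
  have h13 := (hadj 1 3 (by simp)).mpr (by simp)
  have h03 := (hadj 0 3 (by simp)).mpr (by simp)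
  generalize f 0 = a at *
  generalize f 1 = b at *
  generalize f 2 = c at *
  generalize f 3 = d at *
  clear hadj hne h
  -- The middle edge fixes the colour of the outer edges, as their chords are apart. One-way arcs
  -- alternate by transitivity, giving D8 read from one end or the other; bidirectional edges give
  -- D7.
  rcases trichotomy (G := G) n12 with c₂ | c₂ | c₂
  · have c₁ : G.Comparable a b := (trichotomy n01).resolve_right fun h' =>
      h'.elim (fun h' => hrainbow c b a c₂.symm h'.symm h02.symm) h01
    have c₃ : G.Comparable c d := (trichotomy n23).resolve_right fun h' =>
      h'.elim (fun h' => hrainbow b c d c₂ h' h13) h23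
    rcases c₂ with c₂ | c₂
    · have c₁' := c₁.resolve_left fun h' => h02.2.1 (htrans a b c h' c₂).1
      have c₃' := c₃.resolve_left fun h' => h13.2.1 (htrans b c d c₂ h').1
      exact c₁'.2 (g8' c₃'.1 h13.2.2 h03.2.2 c₃'.2 c₂.2 h02.2.2 h13.2.1 c₂.1 c₁'.1 h03.2.1 h02.2.1)
    · have c₁' := c₁.resolve_right fun h' => h02.2.2 (htrans c b a c₂ h').1
      have c₃' := c₃.resolve_right fun h' => h13.2.2 (htrans d c b h' c₂).1
      exact c₃'.2 (g8 c₁'.1 h02.2.1 h03.2.1 c₁'.2 c₂.2 h13.2.1 h02.2.2 c₂.1 c₃'.1 h03.2.2 h13.2.2)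
  · have c₁ : G.Both a b := ((trichotomy n01).resolve_left fun h' =>
      hrainbow a b c h' c₂ h02).resolve_right h01
    have c₃ : G.Both c d := ((trichotomy n23).resolve_left fun h' =>
      hrainbow d c b h'.symm c₂.symm h13.symm).resolve_right h23
    exact g7 c₁.1 h02.2.1 h03.2.1 c₁.2 c₂.1 h13.2.1 h02.2.2 c₂.2 c₃.1 h03.2.2 h13.2.2 c₃.2
  · exact h12 c₂

theorem Free.not_twoK2_isIndContained_un (hG : G.Loopless)
    (h : G.Free {D1, D2, D3, D4, D5, D6, D7, D8, D11.co, D10.co, D9.co, D12, D13, D14, D15}) :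
    ¬ SimpleGraph.twoK2.IsIndContained G.un := by
  rintro ⟨f⟩
  have hne : ∀ i j, i ≠ j → f i ≠ f j := fun i j => f.injective.ne
  have hadj : ∀ i j, i ≠ j → (G.Apart (f i) (f j) ↔ ¬ SimpleGraph.twoK2.Adj i j) :=
    fun i j hij => by rw [← f.map_adj_iff, un_adj_iff_not_apart (hne i j hij), not_not]
  have hl : ∀ x, ¬ G.Adj x x := hG
  have g9 := h.false_of_four_co (by simp : D9.co ∈ _)
  have g10 := h.false_of_four_co (by simp : D10.co ∈ _)
  have g11 := h.false_of_four_co (by simp : D11.co ∈ _)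
  simp [Fin.forall_fin_succ, hl] at g9 g10 g11
  simp only [SimpleGraph.twoK2] at hadj
  have h01 := (hadj (.inl 0) (.inl 1) (by simp)).not.mpr (by simp)
  have h23 := (hadj (.inr 0) (.inr 1) (by simp)).not.mpr (by simp)
  have h02 := (hadj (.inl 0) (.inr 0) (by simp)).mpr (by simp)
  have h03 := (hadj (.inl 0) (.inr 1) (by simp)).mpr (by simp)
  have h12 := (hadj (.inl 1) (.inr 0) (by simp)).mpr (by simp)
  have h13 := (hadj (.inl 1) (.inr 1) (by simp)).mpr (by simp)
  have n01 := hne (.inl 0) (.inl 1) (by simp)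
  have n23 := hne (.inr 0) (.inr 1) (by simp)
  generalize f (.inl 0) = a at *
  generalize f (.inl 1) = b at *
  generalize f (.inr 0) = c at *
  generalize f (.inr 1) = d at *
  clear hadj hne h
  -- The instances account for which of the two edges is a single arc and for the directions of the
  -- single arcs.
  have g9₁ := g9 a b c d
  have g10₁ := g10 a b c d
  have g10₂ := g10 b a c d
  have g10₃ := g10 c d a b
  have g10₄ := g10 d c a b
  have g11₁ := g11 a b c d
  have g11₂ := g11 a b d c
  have g11₃ := g11 b a c d
  have g11₄ := g11 b a d c
  clear g9 g10 g11 hl hG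
  obtain ⟨n02, h02, h20⟩ := h02
  obtain ⟨n13, h13, h31⟩ := h13
  obtain ⟨n03, h03, h30⟩ := h03
  obtain ⟨n12, h12, h21⟩ := h12
  have n10 := n01.symm
  have n20 := n02.symm
  have n30 := n03.symm
  have n21 := n12.symm
  have n31 := n13.symm
  have n32 := n23.symm
  unfold Apart at h01 h23
  by_cases ab : G.Adj a b <;> by_cases ba : G.Adj b a <;> by_cases cd : G.Adj c d <;>
    by_cases dc : G.Adj d c <;> simp_all

end Patterns

end Digraph

/-! ### P₄ and 2K₂ are neither joins nor have isolated vertices -/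

namespace SimpleGraph

theorem IsCoTriviallyPerfect.not_p4_isIndContained {V : Type u} {G : SimpleGraph V}
    (hG : G.IsCoTriviallyPerfect) : ¬ P4.IsIndContained G := by
  refine hG.not_isIndContained ?_ ?_ <;> simp only [P4, pathGraph_adj] <;> decide

theorem IsCoTriviallyPerfect.not_twoK2_isIndContained {V : Type u} {G : SimpleGraph V}
    (hG : G.IsCoTriviallyPerfect) : ¬ twoK2.IsIndContained G := by
  have : Nontrivial (Fin 2 ⊕ Fin 2) := ⟨Sum.inl 0, Sum.inr 0, Sum.inl_ne_inr⟩
  refine hG.not_isIndContained (fun p hp => ?_) ?_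
  · have h₁ := fun i j => hp (Sum.inl i) (Sum.inr j)
    have h₂ := fun i j => hp (Sum.inr i) (Sum.inl j)
    simp [twoK2] at h₁ h₂
    cases h : p (Sum.inl 0) <;> cases h1 : p (Sum.inl 1) <;> cases h2 : p (Sum.inr 0) <;>
      cases h3 : p (Sum.inr 1) <;> simp_all
  · rintro (i | i)
    · exact ⟨Sum.inl (1 - i), by fin_cases i <;> simp [twoK2]⟩
    · exact ⟨Sum.inr (1 - i), by fin_cases i <;> simp [twoK2]⟩

end SimpleGraph

/-! ### The four equivalent characterizations -/

open Digraph in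
theorem mainTheorem12 {V : Type u} [Finite V] [Nonempty V] (G : Digraph V) (hG : G.Loopless) :
    List.TFAE [
      G.IsDirectedCoTriviallyPerfect,
      G.Free {D1, D2, D3, D4, D5, D6, D7, D8, D11.co, D10.co, D9.co, D12, D13, D14, D15},
      G.Free {D1, D2, D3, D4, D5, D6, D12, D13, D14, D15} ∧
        ¬ SimpleGraph.P4.IsIndContained G.un ∧ ¬ SimpleGraph.twoK2.IsIndContained G.un,
      G.Free {D1, D2, D3, D4, D5, D6, D12, D13, D14, D15} ∧ G.un.IsCoTriviallyPerfect] := by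
  have sub : ({D1, D2, D3, D4, D5, D6, D12, D13, D14, D15} : Set OnFin) ⊆
      {D1, D2, D3, D4, D5, D6, D7, D8, D11.co, D10.co, D9.co, D12, D13, D14, D15} := by
    simp [Set.insert_subset_iff]
  tfae_have 1 → 2 := fun h => h.free
  tfae_have 2 → 3 := fun h => ⟨fun D hD => h D (sub hD), h.not_p4_isIndContained_un hG,
    h.not_twoK2_isIndContained_un hG⟩
  tfae_have 3 → 1 := fun h =>
    (restricted_of_free hG h.1 h.2.1 h.2.2).isDirectedCoTriviallyPerfect
  tfae_have 1 → 4 := fun h => ⟨fun D hD => h.free D (sub hD), h.un_isCoTriviallyPerfect⟩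
  tfae_have 4 → 3 := fun h => ⟨h.1, h.2.not_p4_isIndContained, h.2.not_twoK2_isIndContained⟩
  tfae_finish
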